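/- **Lower bound on communication rounds.** Work in $\ell_2$. For functions $f_1,\dots,f_n:\ell_2\to\mathbb R$ held by $n$ nodes, put $f=\frac1n\sum_{i=1}^n f_i$. A gossip matrix of a graph $\mathcal G$ on $\{1,\dots,n\}$ is a matrix $W\in\mathbb R^{n\times n}$ with $W_{ij}=0$ whenever $i\ne j$ and $(i,j)$ is not an edge, and with $\ker W=\{x: x_1=\dots=x_n\}$; for symmetric positive semidefinite $W$ let $\chi(W)=\lambda_{\max}(W)/\lambda_{\min}^+(W)$, where $\lambda_{\min}^+$ is the smallest positive eigenvalue. A *first-order decentralized method* $\mathcal M$ starts from a point $x_0\in\ell_2$ chosen independently of the problem. Run on functions $(f_i)$ and a time-varying network $(\mathcal G_k,W_k)_{k\ge0}$, it makes every time step $k\ge 0$ either a local computation or a communication round (a decision that may depend on the functions and on the network up to time $k$, but not on the future of the network), and the local memories $\mathcal H_i(k)\subseteq\ell_2$ satisfy $\mathcal H_i(0)=\{x_0\}$ and $$\mathcal H_i(k+1)\subseteq\operatorname{span}\{x,\nabla f_i(x),\nabla f_i^*(x):x\in\mathcal H_i(k)\}$$ if step $k$ is a local computation ($f_i^*$ being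 the Fenchel dual), and $$\mathcal H_i(k+1)\subseteq\operatorname{span}\Big(\mathcal H_i(k)\cup\bigcup_{j:\,(i,j)\text{ is an edge of }\mathcal G_k}\mathcal H_j(k)\Big)$$ if step $k$ is a communication round. There are absolute constants $c>0$ and $\varepsilon_0\in(0,1)$ such that for all $\chi\ge56$, all $L>16\mu>0$ and every first-order decentralized method $\mathcal M$ there exist $n$, $L$-smooth and $\mu$-strongly convex functions $f_1,\dots,f_n:\ell_2\to\mathbb R$, graphs $\mathcal G_k$ on $n$ nodes and symmetric positive semidefinite gossip matrices $W_k$ of $\mathcal G_k$ ($k=0,1,\dots$) such that $\chi(W_k)=\chi$ for all $k$, the edge sets of $\mathcal G_k$ and $\mathcal G_{k+1}$ differ in at most two edges for all $k$, $f$ has a minimizer $x_*$, and for every $\varepsilon\in(0,\varepsilon_0]$: if at some time step $k$ some node's memory contains a vector $x$ with $\|x-x_*\|^2\le\varepsilon\|x_0-x_*\|^2$, then $\mathcal M$ has performed at least $$c\,\chi\sqrt{L/\mu}\,\log(1/\varepsilon)$$ communication rounds before time step $k$. -/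

import Mathlib

namespace Decentralized

/-- The Hilbert space `ℓ₂` of square-summable real sequences, on which the local functions live. -/
abbrev Ell2 : Type := lp (fun _ : ℕ => ℝ) 2

/-- `L`-smoothness: `f` is differentiable and its gradient is `L`-Lipschitz. -/
def IsSmooth (L : ℝ) (f : Ell2 → ℝ) : Prop :=
  Differentiable ℝ f ∧ ∀ x y : Ell2, ‖gradient f y - gradient f x‖ ≤ L * ‖y - x‖

/-- `μ`-strong convexity of a differentiable function. -/
def IsStronglyConvex (μ : ℝ) (f : Ell2 → ℝ) : Prop :=
  Differentiable ℝ f ∧ ∀ x y : Ell2,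
    f x + inner ℝ (gradient f x) (y - x) + μ / 2 * ‖y - x‖ ^ 2 ≤ f y

/-- The Fenchel dual `f*(y) = sup_x (⟨y, x⟩ - f x)`. For the strongly convex functions considered
below the supremum is finite. -/
noncomputable def fenchelDual (f : Ell2 → ℝ) (y : Ell2) : ℝ :=
  ⨆ x : Ell2, (inner ℝ y x - f x)

/-- The global function `f = (1/n) ∑ᵢ fᵢ`. -/
noncomputable def globalFunction {n : ℕ} (f : Fin n → Ell2 → ℝ) (x : Ell2) : ℝ :=
  (1 / (n : ℝ)) * ∑ i, f i x

/-- `W` is a gossip matrix of the graph `G`: it vanishes off the diagonal outside the edges, and its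
kernel consists exactly of the constant vectors. -/
def IsGossipMatrix {n : ℕ} (G : SimpleGraph (Fin n)) (W : Matrix (Fin n) (Fin n) ℝ) : Prop :=
  (∀ i j, i ≠ j → ¬ G.Adj i j → W i j = 0) ∧
  (∀ x : Fin n → ℝ, W.mulVec x = 0 ↔ ∀ i j, x i = x j)

/-- The condition number `χ(W) = λ_max(W) / λ_min⁺(W)`: largest eigenvalue over smallest positive
eigenvalue. If there is no positive eigenvalue the value is `0`. -/
noncomputable def conditionNumber {n : ℕ} (W : Matrix (Fin n) (Fin n) ℝ) : ℝ :=
  sSup (spectrum ℝ W) / sInf {l : ℝ | l ∈ spectrum ℝ W ∧ 0 < l}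

/-- The data of a time-varying network on `n` nodes: at each time step a graph and a matrix. -/
structure Network (n : ℕ) where
  graph : ℕ → SimpleGraph (Fin n)
  gossip : ℕ → Matrix (Fin n) (Fin n) ℝ

/-- A first-order decentralized method. Given local functions `f` and a time-varying network `N`, it
decides at each time step `k` whether the step is a communication round (`isComm f N k`) or a local
computation, and it produces the local memories `memory f N k i`, subject to the span conditions.
It starts from a common point chosen before the instance is known. The kind of step `k` may depend
on the functions and on the network up to time `k`, but not on the future of the network. -/
structure FirstOrderMethod where
  start : Ell2
  isComm : {n : ℕ} → (Fin n → Ell2 → ℝ) → Network n → ℕ → Prop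
  memory : {n : ℕ} → (Fin n → Ell2 → ℝ) → Network n → ℕ → Fin n → Set Ell2
  nonanticipating : ∀ {n : ℕ} (f : Fin n → Ell2 → ℝ) (N N' : Network n) (k : ℕ),
    (∀ j ≤ k, N.graph j = N'.graph j ∧ N.gossip j = N'.gossip j) →
      (isComm f N k ↔ isComm f N' k)
  memory_zero : ∀ {n : ℕ} (f : Fin n → Ell2 → ℝ) (N : Network n) (i : Fin n),
    memory f N 0 i = {start}
  memory_local : ∀ {n : ℕ} (f : Fin n → Ell2 → ℝ) (N : Network n) (k : ℕ),
    ¬ isComm f N k → ∀ i : Fin n,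
      memory f N (k + 1) i ⊆
        (Submodule.span ℝ {z : Ell2 | ∃ x ∈ memory f N k i,
          z = x ∨ z = gradient (f i) x ∨ z = gradient (fenchelDual (f i)) x} : Set Ell2)
  memory_comm : ∀ {n : ℕ} (f : Fin n → Ell2 → ℝ) (N : Network n) (k : ℕ),
    isComm f N k → ∀ i : Fin n,
      memory f N (k + 1) i ⊆
        (Submodule.span ℝ {z : Ell2 | ∃ j : Fin n,
          (j = i ∨ (N.graph k).Adj i j) ∧ z ∈ memory f N k j} : Set Ell2)

open Classical in
/-- The number of communication rounds performed by the method before time step `k`. -/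
noncomputable def FirstOrderMethod.commRounds (M : FirstOrderMethod) {n : ℕ}
    (f : Fin n → Ell2 → ℝ) (N : Network n) (k : ℕ) : ℕ :=
  Nat.count (fun j => M.isComm f N j) k

end Decentralized

/-! The instance combines a hard function with a slow network. The function is Nesterov's chain, a
tridiagonal quadratic split between two kinds of nodes: kind 0 couples coordinates `2j, 2j+1`, kind
1 couples `2j-1, 2j`, and kind 2 couples nothing. In coordinates where `x₀` lies on axis 0, the
minimizer minus `x₀` is the geometric sequence `q ^ j`. A memory with only the first `m` coordinates
active has squared relative error at least `q ^ (2 * m)` (`pow_mul_norm_le_norm_sub`), and `log (1 /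
q)` is of order `√(μ / L)`. A new coordinate can only be produced alternately by kinds 0 and 1. This
holds even for Fenchel gradients, by symmetry alone: a function invariant under flipping the signs
of the coordinates after `m` has gradients, and dual gradients, that preserve the fixed space of the
flip.

The network is a double star. Kind 0 surrounds one centre, kind 1 the other, and `k + 3` middle
nodes of kind 2 hang on one centre or the other; only the link node hangs on both. At each
communication round the link moves one step away from the side with newer information, so crossing
takes a full sweep of `k + 3` rounds (`nodeLevel_le_succ`). Each move changes two edges. Heavy link
edges keep the condition number linear in `k`, and two pairs of twin leaves tune it to exactly `χ`
(`starMatrix_spectralFrame`). The network only has to react to past communication rounds, so it can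
be built against the given method (`exists_network`). Hence `r` rounds reach level at most `r / (k +
3) + 1`, with `k` of order `χ`. -/

namespace Decentralized

/-! ### Quadratics built from an isometric involution. -/

section Gradient

variable {E : Type*} [NormedAddCommGroup E] [InnerProductSpace ℝ E]

/-- The quadratic `μ/2 ‖x‖² + κ (‖x‖² - ⟨x, S x⟩) - ⟨h, x⟩`. -/
noncomputable def quadratic (μ κ : ℝ) (S : E ≃ₗᵢ[ℝ] E) (h x : E) : ℝ :=
  μ / 2 * ‖x‖ ^ 2 + κ * (‖x‖ ^ 2 - inner ℝ x (S x)) - inner ℝ h x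

variable {μ κ : ℝ} {S : E ≃ₗᵢ[ℝ] E} {h : E}

lemma inner_involution (hS : ∀ x, S (S x) = x) (x y : E) :
    inner ℝ (S x) y = inner ℝ x (S y) := by
  conv_lhs => rw [← hS y]
  exact S.inner_map_map _ _

lemma quadratic_invariant (R : E ≃ₗᵢ[ℝ] E) (hRS : ∀ x, R (S x) = S (R x)) (hR : ∀ x, R (R x) = x)
    (hh : R h = h) (x : E) : quadratic μ κ S h (R x) = quadratic μ κ S h x := by
  have e : inner ℝ h (R x) = inner ℝ h x := by rw [← inner_involution hR, hh]
  simp only [quadratic, R.norm_map, ← hRS, R.inner_map_map, e]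

variable [CompleteSpace E]

/-- The gradient of a function invariant under a linear isometry commutes with the isometry. -/
lemma gradient_map_of_invariant {f : E → ℝ} (R : E ≃ₗᵢ[ℝ] E) (hf : ∀ x, f (R x) = f x) (x : E) :
    gradient f (R x) = R (gradient f x) := by
  refine ext_inner_right ℝ fun y => ?_
  have h : fderiv ℝ f x = (fderiv ℝ f (R x)).comp (R.toContinuousLinearEquiv : E →L[ℝ] E) := by
    -- The chain rule for an equivalence needs no differentiability, so the Fenchel dual is covered
    -- without any regularity proof.
    have := R.toContinuousLinearEquiv.comp_right_fderiv (f := f) (x := x)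
    rw [show f ∘ R.toContinuousLinearEquiv = f from funext hf] at this
    exact this
  have hy : inner ℝ (R (gradient f x)) y = inner ℝ (gradient f x) (R.symm y) := by
    conv_lhs => rw [← R.apply_symm_apply y]
    exact R.inner_map_map _ _
  rw [hy, inner_gradient_left, inner_gradient_left, h]
  simp

lemma hasGradientAt_quadratic (hS : ∀ x, S (S x) = x) (x : E) :
    HasGradientAt (quadratic μ κ S h) (μ • x + (2 * κ) • (x - S x) - h) x := by
  rw [hasGradientAt_iff_hasFDerivAt]
  have h1 : HasFDerivAt (fun x : E => ‖x‖ ^ 2) _ x := (hasStrictFDerivAt_norm_sq x).hasFDerivAt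
  have h2 : HasFDerivAt (fun x : E => inner ℝ x (S x)) _ x :=
    (hasFDerivAt_id x).inner ℝ (S.toContinuousLinearEquiv : E →L[ℝ] E).hasFDerivAt
  have h3 : HasFDerivAt (fun x : E => inner ℝ h x) _ x := (innerSL ℝ h).hasFDerivAt
  refine (((h1.const_mul (μ / 2)).add ((h1.sub h2).const_mul κ)).sub h3).congr_fderiv ?_
  ext y
  have e1 := inner_involution hS x y
  have e2 := real_inner_comm (S x) y
  simp
  rw [e2, e1]
  ring

lemma gradient_quadratic (hS : ∀ x, S (S x) = x) (x : E) :
    gradient (quadratic μ κ S h) x = μ • x + (2 * κ) • (x - S x) - h :=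
  (hasGradientAt_quadratic hS x).gradient

lemma differentiable_quadratic (hS : ∀ x, S (S x) = x) :
    Differentiable ℝ (quadratic μ κ S h) :=
  fun x => (hasGradientAt_quadratic hS x).differentiableAt

lemma norm_gradient_quadratic_sub_le (hμ : 0 ≤ μ) (hκ : 0 ≤ κ) (hS : ∀ x, S (S x) = x) (x y : E) :
    ‖gradient (quadratic μ κ S h) y - gradient (quadratic μ κ S h) x‖ ≤
      (μ + 4 * κ) * ‖y - x‖ := by
  have e : gradient (quadratic μ κ S h) y - gradient (quadratic μ κ S h) x =
      μ • (y - x) + (2 * κ) • ((y - x) - S (y - x)) := by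
    rw [gradient_quadratic hS, gradient_quadratic hS, map_sub]
    module
  have h1 : ‖(y - x) - S (y - x)‖ ≤ 2 * ‖y - x‖ := by
    refine (norm_sub_le _ _).trans ?_
    rw [S.norm_map]
    linarith
  rw [e]
  refine (norm_add_le _ _).trans ?_
  rw [norm_smul, norm_smul, Real.norm_of_nonneg hμ, Real.norm_of_nonneg (by positivity)]
  nlinarith [mul_le_mul_of_nonneg_left h1 hκ]

/-- As `S` is self-adjoint, the remainder beyond `μ / 2 * ‖d‖ ^ 2` is `κ * (‖d‖ ^ 2 - ⟨d, S d⟩)`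
with `d = y - x`, nonnegative by Cauchy–Schwarz. -/
lemma quadratic_lower_bound (hκ : 0 ≤ κ) (hS : ∀ x, S (S x) = x) (x y : E) :
    quadratic μ κ S h x + inner ℝ (gradient (quadratic μ κ S h) x) (y - x) +
      μ / 2 * ‖y - x‖ ^ 2 ≤ quadratic μ κ S h y := by
  obtain ⟨d, rfl⟩ : ∃ d, y = x + d := ⟨y - x, by abel⟩
  have h1 : inner ℝ d (S d) ≤ ‖d‖ ^ 2 := by
    refine (real_inner_le_norm _ _).trans ?_
    rw [S.norm_map, sq]
  have e1 : inner ℝ d (S x) = inner ℝ x (S d) := by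
    rw [← inner_involution hS, real_inner_comm]
  have e2 : inner ℝ (S x) d = inner ℝ x (S d) := inner_involution hS x d
  rw [gradient_quadratic hS, add_sub_cancel_left]
  simp only [quadratic, norm_add_sq_real, map_add, inner_add_left, inner_add_right,
    inner_sub_left, real_inner_smul_left, e1, e2]
  nlinarith [mul_nonneg hκ (sub_nonneg.2 h1)]

end Gradient

/-- The supremum is reindexed along the bijection `R`; its finiteness plays no role. -/
lemma fenchelDual_invariant {f : Ell2 → ℝ} (R : Ell2 ≃ₗᵢ[ℝ] Ell2) (hf : ∀ x, f (R x) = f x)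
    (y : Ell2) : fenchelDual f (R y) = fenchelDual f y := by
  unfold fenchelDual
  rw [← R.toEquiv.surjective.iSup_comp]
  refine iSup_congr fun x => ?_
  change inner ℝ (R y) (R x) - f (R x) = _
  rw [R.inner_map_map, hf]

lemma isSmooth_quadratic {μ κ : ℝ} {S : Ell2 ≃ₗᵢ[ℝ] Ell2} (h : Ell2) (hμ : 0 ≤ μ) (hκ : 0 ≤ κ)
    (hS : ∀ x, S (S x) = x) : IsSmooth (μ + 4 * κ) (quadratic μ κ S h) :=
  ⟨differentiable_quadratic hS, norm_gradient_quadratic_sub_le hμ hκ hS⟩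

lemma isStronglyConvex_quadratic {μ κ : ℝ} {S : Ell2 ≃ₗᵢ[ℝ] Ell2} (h : Ell2) (hκ : 0 ≤ κ)
    (hS : ∀ x, S (S x) = x) : IsStronglyConvex μ (quadratic μ κ S h) :=
  ⟨differentiable_quadratic hS, quadratic_lower_bound hκ hS⟩

/-- A zero of the sum of the gradients of strongly convex functions minimizes their mean. -/
lemma globalFunction_le_of_sum_gradient_eq_zero {n : ℕ} {μ : ℝ} (hμ : 0 ≤ μ)
    {f : Fin n → Ell2 → ℝ} (hf : ∀ i, IsStronglyConvex μ (f i)) {x : Ell2}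
    (hx : ∑ i, gradient (f i) x = 0) (y : Ell2) : globalFunction f x ≤ globalFunction f y := by
  unfold globalFunction
  refine mul_le_mul_of_nonneg_left ?_ (by positivity)
  have h1 : ∑ i, (f i x + inner ℝ (gradient (f i) x) (y - x)) ≤ ∑ i, f i y := by
    refine Finset.sum_le_sum fun i _ => ?_
    have := (hf i).2 x y
    have : 0 ≤ μ / 2 * ‖y - x‖ ^ 2 := by positivity
    linarith
  rwa [Finset.sum_add_distrib, ← sum_inner, hx, inner_zero_left, add_zero] at h1

/-! ### Signed coordinate involutions and level spaces. -/

section Coordinates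

lemma norm_sq_eq_tsum (x : Ell2) : ‖x‖ ^ 2 = ∑' j, (x j) ^ 2 := by
  have := lp.norm_rpow_eq_tsum (p := 2) (by norm_num) x
  simpa using this

lemma summable_sq (x : Ell2) : Summable fun j => (x j) ^ 2 := by
  have := (lp.memℓp x).summable (by norm_num)
  simpa using this

lemma memℓp_two_iff {u : ℕ → ℝ} : Memℓp u 2 ↔ Summable fun j => (u j) ^ 2 := by
  rw [memℓp_gen_iff (by norm_num)]
  simp

/-- The signed coordinate permutation `(x_j) ↦ (ε_j x_{σ j})` of `ℓ₂`. -/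
noncomputable def signedPerm (σ : Equiv.Perm ℕ) (ε : ℕ → ℤˣ) : Ell2 →ₗᵢ[ℝ] Ell2 where
  toFun x := ⟨fun j => ((ε j : ℤ) : ℝ) * x (σ j), by
    refine memℓp_two_iff.2 ?_
    have h := (σ.summable_iff (f := fun j => (x j) ^ 2)).2 (summable_sq x)
    refine h.congr fun j => ?_
    rcases Int.units_eq_one_or (ε j) with h | h <;> simp [h]⟩
  map_add' x y := by
    ext j
    exact mul_add _ _ _
  map_smul' c x := by
    ext j
    simp [mul_left_comm]
  norm_map' x := by
    rw [← sq_eq_sq₀ (norm_nonneg _) (norm_nonneg _), norm_sq_eq_tsum, norm_sq_eq_tsum,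
      ← σ.tsum_eq (fun j => (x j) ^ 2)]
    refine tsum_congr fun j => ?_
    rcases Int.units_eq_one_or (ε j) with h | h <;> simp [h]

@[simp]
lemma signedPerm_apply (σ : Equiv.Perm ℕ) (ε : ℕ → ℤˣ) (x : Ell2) (j : ℕ) :
    signedPerm σ ε x j = ((ε j : ℤ) : ℝ) * x (σ j) := rfl

/-- The signed coordinate involution `(x_j) ↦ (ε_j x_{σ j})`, for an involution `σ` preserving `ε`,
in the coordinates given by an isometry `U`. -/
noncomputable def signedInvolution (U : Ell2 ≃ₗᵢ[ℝ] Ell2) (σ : ℕ → ℕ) (ε : ℕ → ℤˣ)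
    (hσ : Function.Involutive σ) (hε : ∀ j, ε (σ j) = ε j) : Ell2 ≃ₗᵢ[ℝ] Ell2 :=
  (U.trans (LinearIsometryEquiv.ofSurjective (signedPerm hσ.toPerm ε) (fun x =>
    ⟨signedPerm hσ.toPerm ε x, by
      ext j
      rcases Int.units_eq_one_or (ε j) with h | h <;> simp [hε, hσ j, h]⟩))).trans U.symm

variable (U : Ell2 ≃ₗᵢ[ℝ] Ell2) {σ : ℕ → ℕ} {ε : ℕ → ℤˣ} (hσ : Function.Involutive σ)
  (hε : ∀ j, ε (σ j) = ε j)

@[simp]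
lemma coord_signedInvolution (x : Ell2) (j : ℕ) :
    U (signedInvolution U σ ε hσ hε x) j = ((ε j : ℤ) : ℝ) * U x (σ j) := by
  simp only [signedInvolution, LinearIsometryEquiv.trans_apply,
    LinearIsometryEquiv.apply_symm_apply]
  rfl

lemma ext_coord {x y : Ell2} (h : ∀ j, U x j = U y j) : x = y :=
  U.injective (lp.ext (funext h))

lemma signedInvolution_involutive (x : Ell2) :
    signedInvolution U σ ε hσ hε (signedInvolution U σ ε hσ hε x) = x := by
  refine ext_coord U fun j => ?_
  rcases Int.units_eq_one_or (ε j) with h | h <;> simp [hε, hσ j, h]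

/-- The vectors whose coordinates after the `m`-th vanish. -/
def levelSpace (m : ℕ) : Submodule ℝ Ell2 where
  carrier := {x | ∀ j, m < j → U x j = 0}
  add_mem' hx hy j hj := by simp [hx j hj, hy j hj]
  zero_mem' j _ := by simp
  smul_mem' c x hx j hj := by simp [hx j hj]

lemma levelSpace_mono {m m' : ℕ} (h : m ≤ m') : levelSpace U m ≤ levelSpace U m' :=
  fun _ hx j hj => hx j (h.trans_lt hj)

/-- The isometry changing the sign of the coordinates after the `m`-th. -/
noncomputable def levelFlip (m : ℕ) : Ell2 ≃ₗᵢ[ℝ] Ell2 :=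
  signedInvolution U id (fun j => if m < j then -1 else 1) (fun _ => rfl) (fun _ => rfl)

lemma coord_levelFlip (m : ℕ) (x : Ell2) (j : ℕ) :
    U (levelFlip U m x) j = if m < j then -U x j else U x j := by
  refine (coord_signedInvolution U _ _ x j).trans ?_
  split_ifs <;> simp

lemma levelFlip_apply_eq_iff {m : ℕ} {x : Ell2} :
    levelFlip U m x = x ↔ x ∈ levelSpace U m := by
  constructor
  · intro h j hj
    have : U (levelFlip U m x) j = U x j := by rw [h]
    rw [coord_levelFlip, if_pos hj] at this
    linarith
  · intro h
    refine ext_coord U fun j => ?_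
    rw [coord_levelFlip]
    split_ifs with hj
    · simp [h j hj]
    · rfl

/-- The level space is closed under the gradient of a function that is invariant under the flip. -/
lemma gradient_mem_levelSpace {f : Ell2 → ℝ} {m : ℕ} (hf : ∀ x, f (levelFlip U m x) = f x)
    {x : Ell2} (hx : x ∈ levelSpace U m) : gradient f x ∈ levelSpace U m := by
  rw [← levelFlip_apply_eq_iff] at hx ⊢
  rw [← gradient_map_of_invariant _ hf, hx]

lemma quadratic_levelFlip {μ κ : ℝ} {h : Ell2} {m : ℕ} (hm : ∀ j, m < σ j ↔ m < j)
    (hh : h ∈ levelSpace U m) (x : Ell2) :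
    quadratic μ κ (signedInvolution U σ ε hσ hε) h (levelFlip U m x) =
      quadratic μ κ (signedInvolution U σ ε hσ hε) h x := by
  refine quadratic_invariant (levelFlip U m) (fun x => ext_coord U fun j => ?_)
    (signedInvolution_involutive U _ _) ((levelFlip_apply_eq_iff U).2 hh) x
  simp only [coord_levelFlip, coord_signedInvolution, hm]
  split_ifs <;> ring

end Coordinates

/-! ### The three kinds of chain functions. -/

/-- The coordinate involutions of the three kinds of local functions. The first one exchanges
`2 ↔ 3`, `4 ↔ 5`, ..., the second one exchanges `1 ↔ 2`, `3 ↔ 4`, ..., the third one is trivial. -/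
def chainPerm (c : Fin 3) (j : ℕ) : ℕ :=
  if c = 0 then (if j ≤ 1 then j else if j % 2 = 0 then j + 1 else j - 1)
  else if c = 1 then (if j = 0 then 0 else if j % 2 = 1 then j + 1 else j - 1)
  else j

/-- The first kind of local function changes the sign of the first coordinate. -/
def chainSign (c : Fin 3) (j : ℕ) : ℤˣ := if c = 0 ∧ j = 1 then -1 else 1

lemma chainPerm_involutive (c : Fin 3) : Function.Involutive (chainPerm c) := by
  intro j
  unfold chainPerm
  grind

lemma chainSign_chainPerm (c : Fin 3) (j : ℕ) : chainSign c (chainPerm c j) = chainSign c j := by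
  unfold chainSign chainPerm
  split_ifs <;> first | rfl | (exfalso; omega)

/-- The levels whose coordinate space is invariant under the local functions of kind `c`. -/
def IsClosedLevel (c : Fin 3) (m : ℕ) : Prop := (c = 0 → m % 2 = 1) ∧ (c = 1 → m % 2 = 0)

/-- Only a swapped pair `m ↔ m + 1` could straddle the cut after `m`; the pairs of kind 0 start at
even numbers, those of kind 1 at odd ones. -/
lemma lt_chainPerm_iff {c : Fin 3} {m : ℕ} (hm : IsClosedLevel c m) (j : ℕ) :
    m < chainPerm c j ↔ m < j := by
  obtain ⟨h0, h1⟩ := hm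
  fin_cases c <;> simp [chainPerm] at h0 h1 ⊢ <;> split_ifs <;> omega

section

variable (U : Ell2 ≃ₗᵢ[ℝ] Ell2) (x₀ : Ell2) (μ κ q : ℝ)

/-- The linear terms of the local functions. -/
noncomputable def chainShift (c : Fin 3) : Ell2 :=
  μ • x₀ + (if c = 0 then 2 * κ * (1 + q) else 0) • U.symm (lp.single 2 1 (1 : ℝ))

/-- The local functions of the three kinds. -/
noncomputable def chainFunction (c : Fin 3) : Ell2 → ℝ :=
  quadratic μ κ (signedInvolution U (chainPerm c) (chainSign c) (chainPerm_involutive c)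
    (chainSign_chainPerm c)) (chainShift U x₀ μ κ q c)

variable {U x₀ μ κ q}

lemma chainShift_mem_levelSpace {c : Fin 3} {m : ℕ} (hm : IsClosedLevel c m)
    (h₀ : x₀ ∈ levelSpace U 0) : chainShift U x₀ μ κ q c ∈ levelSpace U m := by
  refine Submodule.add_mem _ (Submodule.smul_mem _ _ (levelSpace_mono U (Nat.zero_le m) h₀)) ?_
  split_ifs with hc
  · refine Submodule.smul_mem _ _ fun j hj => ?_
    have := hm.1 hc
    have hj : j ≠ 1 := by omega
    simp [lp.single_apply, hj]
  · simp

lemma chainFunction_levelFlip {c : Fin 3} {m : ℕ} (hm : IsClosedLevel c m)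
    (h₀ : x₀ ∈ levelSpace U 0) (x : Ell2) :
    chainFunction U x₀ μ κ q c (levelFlip U m x) = chainFunction U x₀ μ κ q c x :=
  quadratic_levelFlip U _ _ (lt_chainPerm_iff hm) (chainShift_mem_levelSpace hm h₀) x

lemma gradient_chainFunction_mem {c : Fin 3} {m : ℕ} (hm : IsClosedLevel c m)
    (h₀ : x₀ ∈ levelSpace U 0) {x : Ell2} (hx : x ∈ levelSpace U m) :
    gradient (chainFunction U x₀ μ κ q c) x ∈ levelSpace U m :=
  gradient_mem_levelSpace U (chainFunction_levelFlip hm h₀) hx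

lemma gradient_fenchelDual_chainFunction_mem {c : Fin 3} {m : ℕ} (hm : IsClosedLevel c m)
    (h₀ : x₀ ∈ levelSpace U 0) {x : Ell2} (hx : x ∈ levelSpace U m) :
    gradient (fenchelDual (chainFunction U x₀ μ κ q c)) x ∈ levelSpace U m :=
  gradient_mem_levelSpace U (fenchelDual_invariant _ (chainFunction_levelFlip hm h₀)) hx

end

/-! ### The minimizer and its distance to the level spaces. -/

/-- The sequence `(0, q, q², ...)`. -/
noncomputable def geometricVector (q : ℝ) (h0 : 0 ≤ q) (h1 : q < 1) : Ell2 :=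
  ⟨fun j => if j = 0 then 0 else q ^ j, by
    refine memℓp_two_iff.2 ?_
    refine Summable.of_nonneg_of_le (fun j => sq_nonneg _) (fun j => ?_)
      (summable_geometric_of_lt_one h0 h1)
    split_ifs with h
    · simp [h]
    · exact pow_le_of_le_one (by positivity) (pow_le_one₀ h0 h1.le) two_ne_zero⟩

section

variable {U : Ell2 ≃ₗᵢ[ℝ] Ell2} {x₀ : Ell2} {μ κ q : ℝ} {h0 : 0 ≤ q} {h1 : q < 1}

@[simp]
lemma geometricVector_apply (j : ℕ) :
    geometricVector q h0 h1 j = if j = 0 then 0 else q ^ j := rfl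

lemma geometricVector_ne_zero (hq : 0 < q) : geometricVector q h0 h1 ≠ 0 := by
  intro h
  have : geometricVector q h0 h1 1 = 0 := by rw [h]; rfl
  simp at this
  exact hq.ne' this

/-- Stationarity is the recurrence `3μ v_j = 2κ (v_{j+1} + v_{j-1} - 2 v_j)`, solved by `q ^ j`.
Kinds 0 and 1 supply one neighbour each, depending on the parity of `j`. -/
lemma sum_gradient_chainFunction (h₀ : x₀ ∈ levelSpace U 0)
    (hq : 3 * μ * q = 2 * κ * (1 - q) ^ 2) :
    ∑ c, gradient (chainFunction U x₀ μ κ q c) (x₀ + U.symm (geometricVector q h0 h1)) = 0 := by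
  refine ext_coord U fun j => ?_
  simp only [chainFunction, gradient_quadratic (signedInvolution_involutive U _ _),
    Fin.sum_univ_three, map_add, map_sub, map_smul, chainShift, LinearIsometryEquiv.apply_symm_apply,
    lp.coeFn_add, lp.coeFn_sub, lp.coeFn_smul, Pi.add_apply, Pi.sub_apply, Pi.smul_apply,
    coord_signedInvolution, smul_eq_mul, map_zero, lp.coeFn_zero, Pi.zero_apply,
    geometricVector_apply]
  have hU : ∀ j, 0 < j → U x₀ j = 0 := h₀
  have hp2 : ∀ j, chainPerm 2 j = j := fun j => rfl
  have hs1 : ∀ j, chainSign 1 j = 1 := fun j => rfl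
  have hs2 : ∀ j, chainSign 2 j = 1 := fun j => rfl
  simp only [hp2, hs1, hs2]
  rcases Nat.lt_or_ge j 2 with hj | hj
  · interval_cases j
    · simp [chainPerm, chainSign, lp.single_apply]
    -- At coordinate 1 the sign flip contributes `4κq`, and the linear term turns this into `2κ (q -
    -- 1)`, as if coordinate 0 of the chain had the value `q ^ 0 = 1`.
    · simp [chainPerm, chainSign, lp.single_apply, hU]
      linear_combination hq
  · have hs0 : chainSign 0 j = 1 := if_neg (by omega)
    have hgeo : 3 * μ * q ^ j = 2 * κ * (q ^ (j + 1) + q ^ (j - 1) - 2 * q ^ j)  := by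
      obtain ⟨i, rfl⟩ := Nat.exists_eq_add_of_le hj
      rw [show 2 + i - 1 = i + 1 by omega]
      linear_combination q ^ (i + 1) * hq
    rcases Nat.mod_two_eq_zero_or_one j with hj2 | hj2
    · have e0 : chainPerm 0 j = j + 1 := by simp [chainPerm, hj2]; omega
      have e1 : chainPerm 1 j = j - 1 := by simp [chainPerm, hj2]; omega
      simp [e0, e1, hs0, lp.single_apply, hU, show 0 < j by omega, show 1 < j by omega,
        show j ≠ 0 by omega, show j ≠ 1 by omega, show j - 1 ≠ 0 by omega]
      linear_combination hgeo
    · have e0 : chainPerm 0 j = j - 1 := by simp [chainPerm, hj2]; omega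
      have e1 : chainPerm 1 j = j + 1 := by simp [chainPerm, hj2]; omega
      simp [e0, e1, hs0, lp.single_apply, hU, show 0 < j by omega, show 1 < j by omega,
        show j ≠ 0 by omega, show j ≠ 1 by omega, show j - 1 ≠ 0 by omega]
      linear_combination hgeo

lemma mul_norm_sq_le_of_shift {c : ℝ} {m : ℕ} {y z : Ell2}
    (h : ∀ j, c * (z j) ^ 2 ≤ (y (j + m)) ^ 2) : c * ‖z‖ ^ 2 ≤ ‖y‖ ^ 2 := by
  rw [norm_sq_eq_tsum, norm_sq_eq_tsum, ← tsum_mul_left]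
  refine le_trans (Summable.tsum_le_tsum h ((summable_sq z).mul_left c)
    ((summable_nat_add_iff m).2 (summable_sq y))) ?_
  exact tsum_comp_le_tsum_of_inj (summable_sq y) (fun j => sq_nonneg _) (add_left_injective m)

/-- Beyond coordinate `m` both `x` and `x₀` vanish, and the tail of the geometric sequence is its
own shift multiplied by `q ^ m`. -/
lemma pow_mul_norm_le_norm_sub (h₀ : x₀ ∈ levelSpace U 0) {m : ℕ} {x : Ell2}
    (hx : x ∈ levelSpace U m) :
    (q ^ m) ^ 2 * ‖x₀ - (x₀ + U.symm (geometricVector q h0 h1))‖ ^ 2 ≤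
      ‖x - (x₀ + U.symm (geometricVector q h0 h1))‖ ^ 2 := by
  rw [sub_add_cancel_left, norm_neg, U.symm.norm_map, ← U.norm_map (x - _)]
  refine mul_norm_sq_le_of_shift (m := m) fun j => ?_
  have e : U (x - (x₀ + U.symm (geometricVector q h0 h1))) (j + m) =
      U x (j + m) - (U x₀ (j + m) + geometricVector q h0 h1 (j + m)) := by
    rw [map_sub, map_add, U.apply_symm_apply]
    rfl
  rw [e]
  rcases Nat.eq_zero_or_pos j with rfl | hj
  · rw [geometricVector_apply, if_pos rfl, zero_pow two_ne_zero, mul_zero]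
    exact sq_nonneg _
  · rw [hx _ (by omega), h₀ _ (by omega), geometricVector_apply, geometricVector_apply,
      if_neg (by omega), if_neg (by omega)]
    refine le_of_eq ?_
    ring

end

/-- There is a coordinate system in which a given vector lies on the zeroth axis. -/
lemma exists_isometry_mem_levelSpace_zero (x : Ell2) :
    ∃ U : Ell2 ≃ₗᵢ[ℝ] Ell2, x ∈ levelSpace U 0 := by
  have h : ‖x‖ = ‖(lp.single 2 0 ‖x‖ : Ell2)‖ := by
    rw [lp.norm_single (by norm_num)]
    simp
  refine ⟨(ℝ ∙ (x - lp.single 2 0 ‖x‖))ᗮ.reflection, fun j hj => ?_⟩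
  rw [Submodule.reflection_sub h]
  simp [lp.single_apply, hj.ne']

/-- Take `q = s ^ 2` with `s` the positive root of `1 - s ^ 2 = √β * s`; then `log (1 / s) ≤ 1 / s -
1 ≤ 1 / s - s = √β`. -/
lemma exists_chain_ratio {β : ℝ} (hβ : 0 < β) :
    ∃ q : ℝ, 0 < q ∧ q < 1 ∧ β * q = (1 - q) ^ 2 ∧ Real.log (1 / q) ≤ 2 * Real.sqrt β := by
  set r := Real.sqrt β with hr
  have hr0 : 0 < r := Real.sqrt_pos.2 hβ
  have hr2 : r ^ 2 = β := Real.sq_sqrt hβ.le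
  set d := Real.sqrt (r ^ 2 + 4)
  have hd2 : d ^ 2 = r ^ 2 + 4 := Real.sq_sqrt (by positivity)
  have hd0 : 0 ≤ d := Real.sqrt_nonneg _
  have hdr : r < d := lt_of_pow_lt_pow_left₀ 2 hd0 (by linarith)
  have hdr2 : d < r + 2 := lt_of_pow_lt_pow_left₀ 2 (by positivity) (by nlinarith)
  set s := (d - r) / 2 with hs
  have hs0 : 0 < s := by linarith
  have hs1 : s < 1 := by linarith
  have hsr : 1 - s ^ 2 = r * s := by rw [hs]; nlinarith
  refine ⟨s ^ 2, by positivity, by nlinarith, ?_, ?_⟩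
  · rw [hsr, ← hr2]; ring
  · rw [one_div, Real.log_inv, Real.log_pow, ← mul_neg, ← Real.log_inv]
    have h1 := Real.log_le_sub_one_of_pos (inv_pos.2 hs0)
    have h2 : s⁻¹ - s = r := by field_simp; linarith
    push_cast
    linarith

open Matrix

/-! ### Extreme eigenvalues from two explicit eigenvectors. -/

section Spectrum

variable {ι : Type*} [Fintype ι]

lemma mem_spectrum_iff_exists_mulVec [DecidableEq ι] (A : Matrix ι ι ℝ) (l : ℝ) :
    l ∈ spectrum ℝ A ↔ ∃ x : ι → ℝ, x ≠ 0 ∧ A *ᵥ x = l • x := by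
  rw [← Matrix.spectrum_toLin', ← Module.End.hasEigenvalue_iff_mem_spectrum]
  constructor
  · intro h
    obtain ⟨x, hx⟩ := h.exists_hasEigenvector
    exact ⟨x, hx.2, by simpa using hx.apply_eq_smul⟩
  · rintro ⟨x, hx, hA⟩
    exact Module.End.hasEigenvalue_of_hasEigenvector
      (Module.End.hasEigenvector_iff.2 ⟨Module.End.mem_eigenspace_iff.2 (by simpa using hA), hx⟩)

lemma dotProduct_mulVec_comm {A : Matrix ι ι ℝ} (hA : A.IsHermitian) (x y : ι → ℝ) :
    x ⬝ᵥ A *ᵥ y = y ⬝ᵥ A *ᵥ x := by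
  have h : A.IsSymm := by simpa using hA
  rw [Matrix.dotProduct_mulVec, ← Matrix.mulVec_transpose, h, dotProduct_comm]

lemma dotProduct_eq_zero_of_eigenvector {A : Matrix ι ι ℝ} (hA : A.IsHermitian) {x y : ι → ℝ}
    {l m : ℝ} (hx : A *ᵥ x = l • x) (hy : A *ᵥ y = m • y) (hlm : l ≠ m) : y ⬝ᵥ x = 0 := by
  have h := dotProduct_mulVec_comm hA x y
  rw [hx, hy, dotProduct_smul, dotProduct_smul, dotProduct_comm x y, smul_eq_mul,
    smul_eq_mul] at h
  have h2 : (l - m) * (y ⬝ᵥ x) = 0 := by linarith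
  exact (mul_eq_zero.1 h2).resolve_left (sub_ne_zero.2 hlm)

/-- A symmetric matrix that annihilates the constants, with explicit eigenvectors to two values `α`
and `β` which bound its quadratic form on the orthogonal complements of these eigenvectors. -/
structure SpectralFrame (A : Matrix ι ι ℝ) (α β : ℝ) (u v : ι → ℝ) (r : ι) : Prop where
  isHermitian : A.IsHermitian
  pos : 0 < α
  le : α ≤ β
  mulVec_one : A *ᵥ 1 = 0
  left_ne_zero : u ≠ 0
  right_ne_zero : v ≠ 0
  mulVec_left : A *ᵥ u = α • u
  mulVec_right : A *ᵥ v = β • v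
  lower : ∀ x : ι → ℝ, u ⬝ᵥ x = 0 → α * ∑ i, (x i - x r) ^ 2 ≤ x ⬝ᵥ A *ᵥ x
  upper : ∀ x : ι → ℝ, v ⬝ᵥ x = 0 → x ⬝ᵥ A *ᵥ x ≤ β * ∑ i, (x i) ^ 2

namespace SpectralFrame

variable {A : Matrix ι ι ℝ} {α β : ℝ} {u v : ι → ℝ} {r : ι}

lemma dotProduct_self_pos {x : ι → ℝ} (hx : x ≠ 0) : 0 < ∑ i, (x i) ^ 2 := by
  obtain ⟨i, hi⟩ := Function.ne_iff.1 hx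
  exact Finset.sum_pos' (fun _ _ => sq_nonneg _) ⟨i, Finset.mem_univ _, by
    have : x i ≠ 0 := hi
    positivity⟩

lemma dotProduct_eigenvector {x : ι → ℝ} {l : ℝ} (hl : A *ᵥ x = l • x) :
    x ⬝ᵥ A *ᵥ x = l * ∑ i, (x i) ^ 2 := by
  rw [hl, dotProduct_smul, smul_eq_mul]
  simp [dotProduct, sq]

/-- An eigenvector to an eigenvalue other than `β` is orthogonal to `v`, so `upper` applies to it.
-/
lemma eigenvalue_le (h : SpectralFrame A α β u v r) {x : ι → ℝ} {l : ℝ} (hx : x ≠ 0)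
    (hl : A *ᵥ x = l • x) : l ≤ β := by
  by_cases hlb : l = β
  · exact hlb.le
  have h1 := h.upper x (dotProduct_eq_zero_of_eigenvector h.isHermitian hl h.mulVec_right hlb)
  rw [dotProduct_eigenvector hl] at h1
  exact le_of_mul_le_mul_right h1 (dotProduct_self_pos hx)

lemma eigenvalue_nonneg (h : SpectralFrame A α β u v r) {x : ι → ℝ} {l : ℝ} (hx : x ≠ 0)
    (hl : A *ᵥ x = l • x) : 0 ≤ l := by
  by_cases hla : l = α
  · exact hla ▸ h.pos.le
  have h1 := h.lower x (dotProduct_eq_zero_of_eigenvector h.isHermitian hl h.mulVec_left hla)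
  rw [dotProduct_eigenvector hl] at h1
  have h2 : 0 ≤ l * ∑ i, (x i) ^ 2 :=
    (mul_nonneg h.pos.le (Finset.sum_nonneg fun _ _ => sq_nonneg _)).trans h1
  exact nonneg_of_mul_nonneg_left h2 (dotProduct_self_pos hx)

/-- The eigenvector has sum zero, and subtracting a constant such as `x r` from a vector of mean
zero cannot decrease its norm. Thus `lower` may be stated relative to a convenient node. -/
lemma le_eigenvalue (h : SpectralFrame A α β u v r) {x : ι → ℝ} {l : ℝ} (hx : x ≠ 0)
    (hl : A *ᵥ x = l • x) (hl0 : 0 < l) : α ≤ l := by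
  by_cases hla : l = α
  · exact hla.ge
  have h1 := h.lower x (dotProduct_eq_zero_of_eigenvector h.isHermitian hl h.mulVec_left hla)
  rw [dotProduct_eigenvector hl] at h1
  have h2 : (1 : ι → ℝ) ⬝ᵥ x = 0 :=
    dotProduct_eq_zero_of_eigenvector h.isHermitian (m := 0) hl (by simp [h.mulVec_one]) hl0.ne'
  rw [one_dotProduct] at h2
  have h3 : ∑ i, (x i) ^ 2 ≤ ∑ i, (x i - x r) ^ 2 := by
    have : ∑ i, (x i - x r) ^ 2 = ∑ i, (x i) ^ 2 - 2 * x r * ∑ i, x i + ∑ _i : ι, (x r) ^ 2 := by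
      rw [Finset.mul_sum, ← Finset.sum_sub_distrib, ← Finset.sum_add_distrib]
      exact Finset.sum_congr rfl fun i _ => by ring
    have h4 : 0 ≤ ∑ _i : ι, (x r) ^ 2 := Finset.sum_nonneg fun _ _ => sq_nonneg _
    rw [this, h2]
    linarith
  exact le_of_mul_le_mul_right ((mul_le_mul_of_nonneg_left h3 h.pos.le).trans h1)
    (dotProduct_self_pos hx)

lemma mulVec_eq_zero_iff (h : SpectralFrame A α β u v r) (x : ι → ℝ) :
    A *ᵥ x = 0 ↔ ∀ i j, x i = x j := by
  constructor
  · intro hx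
    have h1 := h.lower x (dotProduct_eq_zero_of_eigenvector h.isHermitian (l := 0) (by simp [hx])
      h.mulVec_left h.pos.ne)
    rw [hx, dotProduct_zero] at h1
    have h2 : ∑ i, (x i - x r) ^ 2 = 0 :=
      le_antisymm (nonpos_of_mul_nonpos_right h1 h.pos) (Finset.sum_nonneg fun _ _ => sq_nonneg _)
    rw [Finset.sum_eq_zero_iff_of_nonneg fun _ _ => sq_nonneg _] at h2
    have h3 : ∀ i, x i = x r := fun i =>
      sub_eq_zero.1 (pow_eq_zero_iff two_ne_zero |>.1 (h2 i (Finset.mem_univ i)))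
    exact fun i j => (h3 i).trans (h3 j).symm
  · intro hx
    have : x = x r • (1 : ι → ℝ) := by
      ext i
      simp [hx i r]
    rw [this, mulVec_smul, h.mulVec_one, smul_zero]

lemma isGossipMatrix_submatrix (h : SpectralFrame A α β u v r) {n : ℕ} (e : Fin n ≃ ι)
    {G : SimpleGraph ι} (hG : ∀ i j, i ≠ j → ¬ G.Adj i j → A i j = 0) :
    IsGossipMatrix (G.comap e) (A.submatrix e e) := by
  refine ⟨fun i j hij hadj => hG _ _ (e.injective.ne hij) hadj, fun x => ?_⟩
  rw [Matrix.submatrix_mulVec_equiv]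
  constructor
  · intro hx i j
    have h0 : A *ᵥ (x ∘ e.symm) = 0 := by
      ext k
      simpa using congrFun hx (e.symm k)
    simpa using (h.mulVec_eq_zero_iff _).1 h0 (e i) (e j)
  · intro hx
    rw [(h.mulVec_eq_zero_iff (x ∘ e.symm)).2 fun i j => hx _ _]
    rfl

variable [DecidableEq ι]

lemma posSemidef (h : SpectralFrame A α β u v r) : A.PosSemidef := by
  rw [h.isHermitian.posSemidef_iff_eigenvalues_nonneg]
  intro i
  refine h.eigenvalue_nonneg (x := (h.isHermitian.eigenvectorBasis i).ofLp) ?_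
    (h.isHermitian.mulVec_eigenvectorBasis i)
  intro h0
  refine h.isHermitian.eigenvectorBasis.toBasis.ne_zero i ?_
  ext j
  simpa using congrFun h0 j

lemma isGreatest_spectrum (h : SpectralFrame A α β u v r) : IsGreatest (spectrum ℝ A) β := by
  refine ⟨(mem_spectrum_iff_exists_mulVec A β).2 ⟨v, h.right_ne_zero, h.mulVec_right⟩, ?_⟩
  intro l hl
  obtain ⟨x, hx, hl⟩ := (mem_spectrum_iff_exists_mulVec A l).1 hl
  exact h.eigenvalue_le hx hl

lemma isLeast_spectrum_pos (h : SpectralFrame A α β u v r) :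
    IsLeast {l : ℝ | l ∈ spectrum ℝ A ∧ 0 < l} α := by
  refine ⟨⟨(mem_spectrum_iff_exists_mulVec A α).2 ⟨u, h.left_ne_zero, h.mulVec_left⟩, h.pos⟩, ?_⟩
  rintro l ⟨hl, hl0⟩
  obtain ⟨x, hx, hl⟩ := (mem_spectrum_iff_exists_mulVec A l).1 hl
  exact h.le_eigenvalue hx hl hl0

lemma conditionNumber_submatrix (h : SpectralFrame A α β u v r) {n : ℕ} (e : Fin n ≃ ι) :
    conditionNumber (A.submatrix e e) = β / α := by
  have hs : spectrum ℝ (A.submatrix e e) = spectrum ℝ A :=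
    AlgEquiv.spectrum_eq (Matrix.reindexAlgEquiv ℝ ℝ e.symm) A
  rw [conditionNumber, hs, h.isGreatest_spectrum.csSup_eq, h.isLeast_spectrum_pos.csInf_eq]

end SpectralFrame

end Spectrum

/-! ### Weighted tree Laplacians with two modified edges. -/

section TreeMatrix

variable {ι : Type*} [DecidableEq ι]

/-- The difference of two unit vectors. -/
def edgeVec (i j : ι) : ι → ℝ := Pi.single i 1 - Pi.single j 1

lemma edgeVec_apply_mul_apply {i j k l : ι} (hkl : k ≠ l) (h1 : ¬ (i = k ∧ j = l))
    (h2 : ¬ (i = l ∧ j = k)) : edgeVec i j k * edgeVec i j l = 0 := by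
  unfold edgeVec
  simp only [Pi.sub_apply, Pi.single_apply]
  split_ifs <;> simp_all

variable [Fintype ι]

lemma edgeVec_dotProduct (i j : ι) (x : ι → ℝ) : edgeVec i j ⬝ᵥ x = x i - x j := by
  simp [edgeVec, sub_dotProduct]

/-- The weighted Laplacian of the tree with parent function `par`, modified by weights `s` and `-t`
on two further edges `p` and `q`. -/
noncomputable def treeMatrix (par : ι → ι) (wt : ι → ℝ) (p q : ι × ι) (s t : ℝ) : Matrix ι ι ℝ :=
  ∑ i, wt i • vecMulVec (edgeVec i (par i)) (edgeVec i (par i)) +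
    s • vecMulVec (edgeVec p.1 p.2) (edgeVec p.1 p.2) -
    t • vecMulVec (edgeVec q.1 q.2) (edgeVec q.1 q.2)

variable {par : ι → ι} {wt : ι → ℝ} {p q : ι × ι} {s t : ℝ}

lemma dotProduct_treeMatrix_mulVec (x y : ι → ℝ) :
    y ⬝ᵥ treeMatrix par wt p q s t *ᵥ x =
      ∑ i, wt i * ((y i - y (par i)) * (x i - x (par i))) +
        s * ((y p.1 - y p.2) * (x p.1 - x p.2)) - t * ((y q.1 - y q.2) * (x q.1 - x q.2)) := by
  have h (i j : ι) (c : ℝ) : y ⬝ᵥ (c • vecMulVec (edgeVec i j) (edgeVec i j)) *ᵥ x =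
      c * ((y i - y j) * (x i - x j)) := by
    rw [smul_mulVec, vecMulVec_mulVec, dotProduct_smul, edgeVec_dotProduct]
    simp [dotProduct_comm y, edgeVec_dotProduct]
  rw [treeMatrix, sub_mulVec, add_mulVec, dotProduct_sub, dotProduct_add, h, h, sum_mulVec,
    dotProduct_sum]
  simp only [h]

lemma treeMatrix_apply_eq_zero {i j : ι} (hij : i ≠ j) (h1 : par i ≠ j) (h2 : par j ≠ i)
    (hp : ¬ (p.1 = i ∧ p.2 = j)) (hp' : ¬ (p.1 = j ∧ p.2 = i))
    (hq : ¬ (q.1 = i ∧ q.2 = j)) (hq' : ¬ (q.1 = j ∧ q.2 = i)) :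
    treeMatrix par wt p q s t i j = 0 := by
  simp only [treeMatrix, Matrix.sub_apply, Matrix.add_apply, Matrix.sum_apply, Matrix.smul_apply,
    vecMulVec_apply, edgeVec_apply_mul_apply hij hp hp', edgeVec_apply_mul_apply hij hq hq',
    smul_zero, add_zero, sub_zero]
  refine Finset.sum_eq_zero fun k _ => ?_
  rw [edgeVec_apply_mul_apply hij, smul_zero]
  · rintro ⟨rfl, h⟩
    exact h1 h
  · rintro ⟨rfl, h⟩
    exact h2 h

lemma isHermitian_treeMatrix : (treeMatrix par wt p q s t).IsHermitian := by
  have h (i j : ι) (c : ℝ) : (c • vecMulVec (edgeVec i j) (edgeVec i j)).IsHermitian := by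
    ext k l
    simp [vecMulVec_apply, mul_comm]
  refine Matrix.IsHermitian.sub (Matrix.IsHermitian.add ?_ (h _ _ _)) (h _ _ _)
  exact Finset.sum_induction _ Matrix.IsHermitian (fun _ _ => Matrix.IsHermitian.add)
    Matrix.isHermitian_zero fun i _ => h _ _ _

/-- The difference of two leaves with a common parent is an eigenvector of a tree Laplacian. -/
lemma sum_tree_edgeVec {i j : ι} (hij : par i = par j) (hi : wt i = 1) (hj : wt j = 1)
    (hpar : ∀ k, par k ≠ i ∧ par k ≠ j) (y : ι → ℝ) :
    ∑ k, wt k * ((y k - y (par k)) * (edgeVec i j k - edgeVec i j (par k))) = y i - y j := by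
  have h0 : ∀ k, edgeVec i j (par k) = 0 := fun k => by
    simp [edgeVec, (hpar k).1, (hpar k).2]
  have h1 : ∑ k, wt k * ((y k - y (par k)) * (edgeVec i j k - edgeVec i j (par k))) =
      edgeVec i j ⬝ᵥ fun k => wt k * (y k - y (par k)) := by
    simp only [dotProduct, h0]
    exact Finset.sum_congr rfl fun k _ => by ring
  rw [h1, edgeVec_dotProduct, hi, hj, hij]
  ring

end TreeMatrix

/-! ### The double star and its spectrum. -/

section DoubleStar

variable {k : ℕ}

lemma one_ne_two_fin : (1 : Fin (k + 3)) ≠ 2 := by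
  simp [Fin.ext_iff, Nat.mod_eq_of_lt (show 2 < k + 3 by omega)]

lemma two_ne_zero_fin : (2 : Fin (k + 3)) ≠ 0 := by
  simp [Fin.ext_iff, Nat.mod_eq_of_lt (show 2 < k + 3 by omega)]

/-- Adjacency (up to symmetry) in the double star with centres `(0, 0)` and `(1, 0)`: the nodes
`(2, j)` are joined to the first centre for `j ≤ p` and to the second one for `p ≤ j`, and each
centre has a pair of adjacent leaves. -/
def starRel (p : Fin (k + 3)) (u v : Fin 3 × Fin (k + 3)) : Prop :=
  (u.1 = v.1 ∧ u.1 ≠ 2 ∧ (u.2 = 0 ∨ (u.2 = 1 ∧ v.2 = 2))) ∨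
  (u = (0, 0) ∧ v.1 = 2 ∧ v.2 ≤ p) ∨ (u = (1, 0) ∧ v.1 = 2 ∧ p ≤ v.2)

/-- The double star in which the two centres are linked through the node `(2, p)`. -/
def starGraph (p : Fin (k + 3)) : SimpleGraph (Fin 3 × Fin (k + 3)) :=
  SimpleGraph.fromRel (starRel p)

/-- The parent function of the double star rooted at the linking node. -/
def starPar (p : Fin (k + 3)) (v : Fin 3 × Fin (k + 3)) : Fin 3 × Fin (k + 3) :=
  if v.1 = 2 then (if v.2 < p then (0, 0) else if p < v.2 then (1, 0) else v)
  else if v.2 = 0 then (2, p) else (v.1, 0)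

/-- The weights of the edges of the double star: only the link of the two centres is heavy. -/
noncomputable def starWeight (v : Fin 3 × Fin (k + 3)) : ℝ :=
  if v.1 ≠ 2 ∧ v.2 = 0 then 2 * ((k : ℝ) + 3) + 1 / 2 else 1

/-- The gossip matrix of the double star, with smallest positive eigenvalue `1 / 2` and largest
eigenvalue `β`. -/
noncomputable def starMatrix (β : ℝ) (p : Fin (k + 3)) :
    Matrix (Fin 3 × Fin (k + 3)) (Fin 3 × Fin (k + 3)) ℝ :=
  treeMatrix (starPar p) starWeight ((0, 1), (0, 2)) ((1, 1), (1, 2)) ((β - 1) / 2) (1 / 4)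

lemma starGraph_adj_starPar (p : Fin (k + 3)) (v : Fin 3 × Fin (k + 3)) (h : v ≠ starPar p v) :
    (starGraph p).Adj v (starPar p v) := by
  rw [starGraph, SimpleGraph.fromRel_adj]
  refine ⟨h, ?_⟩
  obtain ⟨c, j⟩ := v
  simp only [starPar, starRel] at h ⊢
  fin_cases c <;> simp at h ⊢ <;> split_ifs at h ⊢ <;> simp_all [le_of_lt]
  exact lt_asymm ‹j < p› ‹p < j›

lemma starMatrix_apply_eq_zero (β : ℝ) (p : Fin (k + 3)) {u v : Fin 3 × Fin (k + 3)} (huv : u ≠ v)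
    (h : ¬ (starGraph p).Adj u v) : starMatrix β p u v = 0 := by
  have h' : ¬ (starGraph p).Adj v u := fun h' => h h'.symm
  have hc (c : Fin 3) (hc : c ≠ 2) : (starGraph p).Adj (c, 1) (c, 2) := by
    rw [starGraph, SimpleGraph.fromRel_adj]
    refine ⟨?_, Or.inl (Or.inl ⟨rfl, hc, Or.inr ⟨rfl, rfl⟩⟩)⟩
    simp [one_ne_two_fin]
  refine treeMatrix_apply_eq_zero huv ?_ ?_ ?_ ?_ ?_ ?_
  · rintro rfl
    exact h (starGraph_adj_starPar p u huv)
  · rintro rfl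
    exact h' (starGraph_adj_starPar p v huv.symm)
  · rintro ⟨rfl, rfl⟩
    exact h (hc 0 (by decide))
  · rintro ⟨rfl, rfl⟩
    exact h' (hc 0 (by decide))
  · rintro ⟨rfl, rfl⟩
    exact h (hc 1 (by decide))
  · rintro ⟨rfl, rfl⟩
    exact h' (hc 1 (by decide))

/-- The weight of the heavy edge is chosen here: after paying for the leaves of its centre it leaves
a surplus of `2 * (k + 3)`, which pays for the middle nodes in `tree_term_lower_middle`. With unit
weight the spectral gap would shrink as `k` grows. -/
lemma tree_term_lower_centre (p : Fin (k + 3)) (x : Fin 3 × Fin (k + 3) → ℝ) {c : Fin 3}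
    (hc : c ≠ 2) :
    ∑ j, (x (c, j) - x (2, p)) ^ 2 ≤
      2 * ∑ j, starWeight (c, j) * (x (c, j) - x (starPar p (c, j))) ^ 2 -
        2 * ((k : ℝ) + 3) * (x (c, 0) - x (2, p)) ^ 2 := by
  have h : ∀ j, (x (c, j) - x (2, p)) ^ 2 ≤
      2 * (starWeight (c, j) * (x (c, j) - x (starPar p (c, j))) ^ 2) +
        2 * (x (c, 0) - x (2, p)) ^ 2 -
          if j = 0 then 4 * ((k : ℝ) + 3) * (x (c, 0) - x (2, p)) ^ 2 else 0 := by
    intro j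
    by_cases hj : j = 0
    · subst hj
      simp only [starWeight, starPar, hc, ne_eq, not_false_eq_true, and_self, if_true, if_false]
      nlinarith [sq_nonneg (x (c, 0) - x (2, p))]
    · simp only [starWeight, starPar, hc, hj, ne_eq, and_false, if_false]
      nlinarith [sq_nonneg (x (c, j) - 2 * x (c, 0) + x (2, p))]
  refine (Finset.sum_le_sum fun j _ => h j).trans (le_of_eq ?_)
  rw [Finset.sum_sub_distrib, Finset.sum_add_distrib, ← Finset.mul_sum, Finset.sum_const,
    Finset.sum_ite_eq']
  simp
  ring

lemma tree_term_lower_middle (p : Fin (k + 3)) (x : Fin 3 × Fin (k + 3) → ℝ) :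
    ∑ j, (x (2, j) - x (2, p)) ^ 2 ≤
      2 * ∑ j, starWeight (2, j) * (x (2, j) - x (starPar p (2, j))) ^ 2 +
        2 * ((k : ℝ) + 3) * ((x (0, 0) - x (2, p)) ^ 2 + (x (1, 0) - x (2, p)) ^ 2) := by
  have h : ∀ j, (x (2, j) - x (2, p)) ^ 2 ≤
      2 * (starWeight (2, j) * (x (2, j) - x (starPar p (2, j))) ^ 2) +
        2 * ((x (0, 0) - x (2, p)) ^ 2 + (x (1, 0) - x (2, p)) ^ 2) := by
    intro j
    simp only [starWeight, starPar, ne_eq, not_true_eq_false, false_and, if_true, if_false]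
    rcases lt_trichotomy j p with hj | rfl | hj
    · simp only [hj, if_true]
      nlinarith [sq_nonneg (x (2, j) - 2 * x (0, 0) + x (2, p)), sq_nonneg (x (1, 0) - x (2, p))]
    · simp
      positivity
    · simp only [hj, hj.not_gt, if_true, if_false]
      nlinarith [sq_nonneg (x (2, j) - 2 * x (1, 0) + x (2, p)), sq_nonneg (x (0, 0) - x (2, p))]
  refine (Finset.sum_le_sum fun j _ => h j).trans (le_of_eq ?_)
  rw [Finset.sum_add_distrib, ← Finset.mul_sum, Finset.sum_const]
  simp
  ring

lemma tree_form_lower (p : Fin (k + 3)) (x : Fin 3 × Fin (k + 3) → ℝ) :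
    1 / 2 * ∑ v, (x v - x (2, p)) ^ 2 ≤ ∑ v, starWeight v * (x v - x (starPar p v)) ^ 2 := by
  simp only [Fintype.sum_prod_type, Fin.sum_univ_three]
  have h0 := tree_term_lower_centre p x (c := 0) (by decide)
  have h1 := tree_term_lower_centre p x (c := 1) (by decide)
  have h2 := tree_term_lower_middle p x
  linarith

lemma tree_term_upper_centre (p : Fin (k + 3)) (x : Fin 3 × Fin (k + 3) → ℝ) {c : Fin 3}
    (hc : c ≠ 2) :
    ∑ j, starWeight (c, j) * (x (c, j) - x (starPar p (c, j))) ^ 2 ≤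
      2 * ∑ j, (x (c, j)) ^ 2 + 2 * ((k : ℝ) + 3) * (x (c, 0)) ^ 2 +
        (4 * ((k : ℝ) + 3) + 1) * ((x (c, 0)) ^ 2 + (x (2, p)) ^ 2) := by
  have h : ∀ j, starWeight (c, j) * (x (c, j) - x (starPar p (c, j))) ^ 2 ≤
      2 * (x (c, j)) ^ 2 + 2 * (x (c, 0)) ^ 2 +
        if j = 0 then (4 * ((k : ℝ) + 3) + 1) * ((x (c, 0)) ^ 2 + (x (2, p)) ^ 2) else 0 := by
    intro j
    by_cases hj : j = 0
    · subst hj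
      simp only [starWeight, starPar, hc, ne_eq, not_false_eq_true, and_self, if_true, if_false]
      have hk : (0 : ℝ) ≤ 2 * ((k : ℝ) + 3) + 1 / 2 := by positivity
      nlinarith [mul_nonneg hk (sq_nonneg (x (c, 0) + x (2, p))), sq_nonneg (x (c, 0))]
    · simp only [starWeight, starPar, hc, hj, ne_eq, and_false, if_false]
      nlinarith [sq_nonneg (x (c, j) + x (c, 0))]
  refine (Finset.sum_le_sum fun j _ => h j).trans (le_of_eq ?_)
  rw [Finset.sum_add_distrib, Finset.sum_add_distrib, ← Finset.mul_sum, Finset.sum_const,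
    Finset.sum_ite_eq']
  simp
  ring

lemma tree_term_upper_middle (p : Fin (k + 3)) (x : Fin 3 × Fin (k + 3) → ℝ) :
    ∑ j, starWeight (2, j) * (x (2, j) - x (starPar p (2, j))) ^ 2 ≤
      2 * ∑ j, (x (2, j)) ^ 2 + 2 * ((k : ℝ) + 3) * ((x (0, 0)) ^ 2 + (x (1, 0)) ^ 2) := by
  have h : ∀ j, starWeight (2, j) * (x (2, j) - x (starPar p (2, j))) ^ 2 ≤
      2 * (x (2, j)) ^ 2 + 2 * ((x (0, 0)) ^ 2 + (x (1, 0)) ^ 2) := by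
    intro j
    simp only [starWeight, starPar, ne_eq, not_true_eq_false, false_and, if_true, if_false]
    rcases lt_trichotomy j p with hj | rfl | hj
    · simp only [hj, if_true]
      nlinarith [sq_nonneg (x (2, j) + x (0, 0)), sq_nonneg (x (1, 0))]
    · simp
      positivity
    · simp only [hj, hj.not_gt, if_true, if_false]
      nlinarith [sq_nonneg (x (2, j) + x (1, 0)), sq_nonneg (x (0, 0))]
  refine (Finset.sum_le_sum fun j _ => h j).trans (le_of_eq ?_)
  rw [Finset.sum_add_distrib, ← Finset.mul_sum, Finset.sum_const]
  simp
  ring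

/-- The largest coefficient, `8 * (k + 3) + 4`, comes from the link node, where both heavy edges
meet. -/
lemma tree_form_upper (p : Fin (k + 3)) (x : Fin 3 × Fin (k + 3) → ℝ) :
    ∑ v, starWeight v * (x v - x (starPar p v)) ^ 2 ≤ (8 * ((k : ℝ) + 3) + 4) * ∑ v, (x v) ^ 2 := by
  simp only [Fintype.sum_prod_type, Fin.sum_univ_three]
  have h0 := tree_term_upper_centre p x (c := 0) (by decide)
  have h1 := tree_term_upper_centre p x (c := 1) (by decide)
  have h2 := tree_term_upper_middle p x
  have s (c : Fin 3) (j : Fin (k + 3)) : (x (c, j)) ^ 2 ≤ ∑ j, (x (c, j)) ^ 2 :=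
    Finset.single_le_sum (f := fun j => (x (c, j)) ^ 2) (fun _ _ => sq_nonneg _)
      (Finset.mem_univ j)
  have hk : (0 : ℝ) ≤ 8 * ((k : ℝ) + 3) + 2 := by positivity
  have s0 := mul_le_mul_of_nonneg_left (s 0 0) hk
  have s1 := mul_le_mul_of_nonneg_left (s 1 0) hk
  have s2 := mul_le_mul_of_nonneg_left (s 2 p) hk
  nlinarith [sq_nonneg (x (0, 0)), sq_nonneg (x (1, 0))]

lemma starPar_ne {p : Fin (k + 3)} {c : Fin 3} (hc : c ≠ 2) {j : Fin (k + 3)} (hj : j ≠ 0)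
    (v : Fin 3 × Fin (k + 3)) : starPar p v ≠ (c, j) := by
  unfold starPar
  split_ifs with h <;> intro h' <;> rw [Prod.ext_iff] at h'
  · exact hj h'.2.symm
  · exact hj h'.2.symm
  · exact hc (h'.1.symm.trans h)
  · exact hc h'.1.symm
  · exact hj h'.2.symm

lemma sum_tree_twins (p : Fin (k + 3)) {c : Fin 3} (hc : c ≠ 2) (y : Fin 3 × Fin (k + 3) → ℝ) :
    ∑ v, starWeight v * ((y v - y (starPar p v)) *
      (edgeVec (c, 1) (c, 2) v - edgeVec (c, 1) (c, 2) (starPar p v))) = y (c, 1) - y (c, 2) := by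
  have h1 : (1 : Fin (k + 3)) ≠ 0 := by simp
  have h2 : (2 : Fin (k + 3)) ≠ 0 := two_ne_zero_fin
  refine sum_tree_edgeVec ?_ ?_ ?_ (fun v => ⟨starPar_ne hc h1 v, starPar_ne hc h2 v⟩) y
  · simp [starPar, hc, h1, h2]
  · simp [starWeight, h1]
  · simp [starWeight, h2]

/-- A difference of twin leaves has tree eigenvalue 1, and an extra edge of weight `w` between the
twins makes it `1 + 2 * w`: the weights `(β - 1) / 2` and `-1 / 4` give `β` and `1 / 2`. On the
orthogonal complement of such a difference its extra edge contributes nothing, while the other edge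
has the favourable sign. -/
lemma starMatrix_spectralFrame {β : ℝ} (p : Fin (k + 3)) (hβ : 8 * ((k : ℝ) + 3) + 4 ≤ β) :
    SpectralFrame (starMatrix β p) (1 / 2) β (edgeVec (1, 1) (1, 2)) (edgeVec (0, 1) (0, 2))
      (2, p) := by
  have h12 : (1 : Fin (k + 3)) ≠ 2 := one_ne_two_fin
  have hk : (0 : ℝ) ≤ k := by positivity
  have hne (c : Fin 3) : edgeVec (c, (1 : Fin (k + 3))) (c, 2) ≠ 0 := by
    intro h
    have := congrFun h (c, 1)
    simp [edgeVec, h12] at this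
  refine ⟨isHermitian_treeMatrix, by norm_num, by linarith, ?_, hne 1, hne 0, ?_, ?_, ?_, ?_⟩
  · refine (dotProduct_eq _ _ fun y => ?_)
    rw [dotProduct_comm, starMatrix, dotProduct_treeMatrix_mulVec]
    simp
  · refine (dotProduct_eq _ _ fun y => ?_)
    rw [dotProduct_comm, starMatrix, dotProduct_treeMatrix_mulVec, sum_tree_twins p (by decide),
      smul_dotProduct, edgeVec_dotProduct]
    simp [edgeVec, h12, h12.symm]
    ring
  · refine (dotProduct_eq _ _ fun y => ?_)
    rw [dotProduct_comm, starMatrix, dotProduct_treeMatrix_mulVec, sum_tree_twins p (by decide),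
      smul_dotProduct, edgeVec_dotProduct]
    simp [edgeVec, h12, h12.symm]
    ring
  · intro x hx
    rw [edgeVec_dotProduct] at hx
    rw [starMatrix, dotProduct_treeMatrix_mulVec]
    simp only [hx, ← sq]
    have := tree_form_lower p x
    have : 0 ≤ (β - 1) / 2 * (x (0, 1) - x (0, 2)) ^ 2 :=
      mul_nonneg (by linarith) (sq_nonneg _)
    linarith
  · intro x hx
    rw [edgeVec_dotProduct] at hx
    rw [starMatrix, dotProduct_treeMatrix_mulVec]
    simp only [hx, ← sq]
    have h1 := tree_form_upper p x
    have h2 : (8 * ((k : ℝ) + 3) + 4) * ∑ v, (x v) ^ 2 ≤ β * ∑ v, (x v) ^ 2 :=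
      mul_le_mul_of_nonneg_right hβ (Finset.sum_nonneg fun _ _ => sq_nonneg _)
    have := sq_nonneg (x (1, 1) - x (1, 2))
    linarith

end DoubleStar

/-! ### The moving link and the spread of information. -/

section SlowChange

variable {k : ℕ}

lemma starGraph_edge_change {p p' : Fin (k + 3)} (h : (p' : ℕ) = p + 1) :
    symmDiff (starGraph p).edgeSet (starGraph p').edgeSet ⊆
      {s((0, 0), (2, p')), s((1, 0), (2, p))} := by
  intro e
  induction e with | h u v => ?_
  have h1 : ∀ u v, starRel p u v → ¬ starRel p' u v → u = (1, 0) ∧ v = (2, p) := by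
    rintro u ⟨c, j⟩ (h1 | ⟨rfl, rfl, h1⟩ | ⟨rfl, rfl, h1⟩) h2
    · exact absurd (Or.inl h1) h2
    · refine absurd (Or.inr (Or.inl ⟨rfl, rfl, ?_⟩)) h2
      simp only [Fin.le_def] at h1 ⊢
      omega
    · refine ⟨rfl, Prod.ext rfl (le_antisymm ?_ h1)⟩
      by_contra h3
      refine h2 (Or.inr (Or.inr ⟨rfl, rfl, ?_⟩))
      simp only [Fin.le_def] at h3 ⊢
      omega
  have h2 : ∀ u v, starRel p' u v → ¬ starRel p u v → u = (0, 0) ∧ v = (2, p') := by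
    rintro u ⟨c, j⟩ (h1 | ⟨rfl, rfl, h1⟩ | ⟨rfl, rfl, h1⟩) h2
    · exact absurd (Or.inl h1) h2
    · refine ⟨rfl, Prod.ext rfl (le_antisymm h1 ?_)⟩
      by_contra h3
      refine h2 (Or.inr (Or.inl ⟨rfl, rfl, ?_⟩))
      simp only [Fin.le_def] at h3 ⊢
      omega
    · refine absurd (Or.inr (Or.inr ⟨rfl, rfl, ?_⟩)) h2
      simp only [Fin.le_def] at h1 ⊢
      omega
  simp only [Set.mem_symmDiff, SimpleGraph.mem_edgeSet, starGraph, SimpleGraph.fromRel_adj,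
    Set.mem_insert_iff, Set.mem_singleton_iff, Sym2.eq_iff]
  rintro (⟨⟨hne, h | h⟩, h'⟩ | ⟨⟨hne, h | h⟩, h'⟩)
  · exact Or.inr (Or.inl (h1 u v h fun h3 => h' ⟨hne, Or.inl h3⟩))
  · exact Or.inr (Or.inr (h1 v u h fun h3 => h' ⟨hne, Or.inr h3⟩).symm)
  · exact Or.inl (Or.inl (h2 u v h fun h3 => h' ⟨hne, Or.inl h3⟩))
  · exact Or.inl (Or.inr (h2 v u h fun h3 => h' ⟨hne, Or.inr h3⟩).symm)

lemma ncard_symmDiff_comap_edgeSet_le {n : ℕ} (e : Fin n ≃ Fin 3 × Fin (k + 3))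
    {p p' : Fin (k + 3)} (h1 : (p' : ℕ) ≤ p + 1) (h2 : (p : ℕ) ≤ p' + 1) :
    (symmDiff ((starGraph p).comap e).edgeSet ((starGraph p').comap e).edgeSet).ncard ≤ 2 := by
  have key : ∀ p p' : Fin (k + 3), (p' : ℕ) = p + 1 →
      (symmDiff ((starGraph p).comap e).edgeSet ((starGraph p').comap e).edgeSet).ncard ≤ 2 := by
    intro p p' h
    refine (Set.ncard_le_ncard_of_injOn (Sym2.map e) (fun x hx => ?_)
      (Sym2.map.injective e.injective).injOn (Set.toFinite _)).trans
      ((Set.ncard_insert_le s((0, 0), (2, p')) {s((1, 0), (2, p))}).trans (by simp))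
    refine starGraph_edge_change h ?_
    induction x with | h u v => ?_
    exact hx
  rcases lt_trichotomy (p : ℕ) p' with h | h | h
  · exact key p p' (by omega)
  · rw [Fin.ext h]
    simp
  · rw [symmDiff_comm]
    exact key p' p (by omega)

/-- The linking node after `r` communication rounds: it moves to and fro through the middle. -/
def linkNode (k r : ℕ) : Fin (k + 3) :=
  if r / (k + 3) % 2 = 0 then ⟨r % (k + 3), Nat.mod_lt _ (by omega)⟩
  else Fin.rev ⟨r % (k + 3), Nat.mod_lt _ (by omega)⟩

lemma succ_div_mod (K r : ℕ) (hK : 0 < K) :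
    ((r + 1) / K = r / K ∧ (r + 1) % K = r % K + 1 ∧ r % K + 1 < K) ∨
      ((r + 1) / K = r / K + 1 ∧ (r + 1) % K = 0 ∧ r % K + 1 = K) := by
  have h1 := Nat.div_add_mod r K
  have h2 := Nat.mod_lt r hK
  rcases Nat.lt_or_ge (r % K + 1) K with h | h
  · left
    have e : r + 1 = K * (r / K) + (r % K + 1) := by omega
    refine ⟨?_, ?_, h⟩
    · conv_lhs => rw [e]
      rw [Nat.mul_add_div hK, Nat.div_eq_of_lt h, add_zero]
    · conv_lhs => rw [e]
      rw [Nat.mul_add_mod, Nat.mod_eq_of_lt h]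
  · right
    have e : r + 1 = K * (r / K + 1) := by rw [mul_add, mul_one]; omega
    refine ⟨?_, ?_, by omega⟩
    · rw [e, Nat.mul_div_cancel_left _ hK]
    · rw [e, Nat.mul_mod_right]

lemma linkNode_succ (k r : ℕ) :
    (linkNode k (r + 1) : ℕ) ≤ linkNode k r + 1 ∧ (linkNode k r : ℕ) ≤ linkNode k (r + 1) + 1 := by
  unfold linkNode
  rcases succ_div_mod (k + 3) r (by omega) with ⟨h1, h2, h3⟩ | ⟨h1, h2, h3⟩
  · simp only [h1, h2]
    split_ifs <;> simp only [Fin.val_rev] <;> omega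
  -- At a turn the link rests: the last node of a sweep is the first node of the next.
  · simp only [h1, h2]
    split_ifs <;> simp only [Fin.val_rev] <;> omega

/-- The nodes that already have the coordinate produced last. -/
def IsAhead (t : ℕ) (p : Fin (k + 3)) (v : Fin 3 × Fin (k + 3)) : Prop :=
  if t % 2 = 0 then v.1 = 0 ∨ (v.1 = 2 ∧ v.2 < p) else v.1 = 1 ∨ (v.1 = 2 ∧ p < v.2)

open Classical in
/-- A bound for the coordinates that a node can have reached after `r` communication rounds. -/
noncomputable def nodeLevel (r : ℕ) (v : Fin 3 × Fin (k + 3)) : ℕ :=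
  r / (k + 3) + if IsAhead (r / (k + 3)) (linkNode k r) v then 1 else 0

lemma nodeLevel_le (r : ℕ) (v : Fin 3 × Fin (k + 3)) : nodeLevel r v ≤ r / (k + 3) + 1 := by
  unfold nodeLevel
  split_ifs <;> omega

lemma le_nodeLevel (r : ℕ) (v : Fin 3 × Fin (k + 3)) : r / (k + 3) ≤ nodeLevel r v :=
  Nat.le_add_right _ _

/-- In sweep `t`, the kind that is ahead sits at level `t + 1` and the other at `t`; the parities
are such that neither can advance by local steps. -/
lemma isClosedLevel_nodeLevel (r : ℕ) (v : Fin 3 × Fin (k + 3)) :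
    IsClosedLevel v.1 (nodeLevel r v) := by
  unfold nodeLevel IsAhead
  refine ⟨fun h => ?_, fun h => ?_⟩ <;> simp only [h] <;> split_ifs with h1 h2 h2 <;>
    simp at h2 <;> omega

/-- The link alone touches both centres and is not ahead. It may receive the new coordinate in this
round, but by then the link has moved on to `p'`. -/
lemma IsAhead.of_adj {t : ℕ} {p p' : Fin (k + 3)} {u v : Fin 3 × Fin (k + 3)}
    (hp : if t % 2 = 0 then p < p' else p' < p) (huv : u = v ∨ (starGraph p).Adj u v)
    (hv : IsAhead t p v) : IsAhead t p' u := by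
  obtain ⟨a, i⟩ := u
  obtain ⟨b, j⟩ := v
  simp only [starGraph, SimpleGraph.fromRel_adj, starRel, Prod.ext_iff] at huv
  unfold IsAhead at hv ⊢
  split_ifs at hp hv ⊢ with ht
  · grind
  · grind

lemma nodeLevel_le_succ (r : ℕ) {u v : Fin 3 × Fin (k + 3)}
    (huv : u = v ∨ (starGraph (linkNode k r)).Adj u v) :
    nodeLevel r v ≤ nodeLevel (r + 1) u := by
  rcases succ_div_mod (k + 3) r (by omega) with ⟨h1, h2, h3⟩ | ⟨h1, h2, h3⟩
  · by_cases hv : IsAhead (r / (k + 3)) (linkNode k r) v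
    · have hu : IsAhead ((r + 1) / (k + 3)) (linkNode k (r + 1)) u := by
        rw [h1]
        refine hv.of_adj ?_ huv
        unfold linkNode
        simp only [h1, h2]
        split_ifs
        · simp [Fin.lt_def]
        · simp [Fin.lt_def]
          omega
      simp only [nodeLevel, if_pos hv, if_pos hu, h1, le_refl]
    · simp only [nodeLevel, if_neg hv, h1]
      omega
  -- When a sweep ends the base level rises by one, so the crude bounds suffice and every node may
  -- catch up.
  · have := nodeLevel_le r v
    have := le_nodeLevel (r + 1) u
    omega

end SlowChange

/-! ### A network adapted to the method. -/

section Adversary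

/-- The network that is in state `c j` at time `j`. -/
def stateNetwork {n : ℕ} (G : ℕ → SimpleGraph (Fin n)) (W : ℕ → Matrix (Fin n) (Fin n) ℝ)
    (c : ℕ → ℕ) : Network n := ⟨fun j => G (c j), fun j => W (c j)⟩

/-- A network whose state is at each time the number of communication rounds so far. -/
lemma FirstOrderMethod.exists_network (M : FirstOrderMethod) {n : ℕ} (f : Fin n → Ell2 → ℝ)
    (G : ℕ → SimpleGraph (Fin n)) (W : ℕ → Matrix (Fin n) (Fin n) ℝ) :
    ∃ N : Network n, ∀ k, N.graph k = G (M.commRounds f N k) ∧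
      N.gossip k = W (M.commRounds f N k) := by
  classical
  -- Asking `isComm` requires a whole network: `hist k` is the right state sequence up to time `k`,
  -- frozen afterwards. Nonanticipation makes the answer at time `k` independent of the frozen tail.
  let hist : ℕ → ℕ → ℕ := fun k => Nat.rec (fun _ => 0) (fun k h j => if j ≤ k then h j else
    h k + if M.isComm f (stateNetwork G W h) k then 1 else 0) k
  have hist_succ : ∀ k j, hist (k + 1) j = if j ≤ k then hist k j else
    hist k k + if M.isComm f (stateNetwork G W (hist k)) k then 1 else 0 := fun _ _ => rfl
  have stable : ∀ k j, j ≤ k → hist k j = hist j j := by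
    intro k
    induction k with
    | zero => intro j hj; rw [Nat.le_zero.1 hj]
    | succ k ih =>
      intro j hj
      rcases Nat.lt_or_ge k j with h | h
      · rw [show j = k + 1 by omega]
      · rw [hist_succ, if_pos h, ih j h]
  let N := stateNetwork G W fun j => hist j j
  have hN : ∀ k, M.isComm f (stateNetwork G W (hist k)) k ↔ M.isComm f N k := by
    refine fun k => M.nonanticipating f _ _ k fun j hj => ?_
    simp only [N, stateNetwork, stable k j hj, and_self]
  have hc : ∀ k, hist k k = M.commRounds f N k := by
    intro k
    induction k with
    | zero => simp [commRounds, hist]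
    | succ k ih =>
      rw [hist_succ, if_neg (by omega), ih]
      rw [commRounds, commRounds, Nat.count_succ]
      exact congrArg _ (if_congr (hN k) rfl rfl)
  exact ⟨N, fun k => ⟨congrArg G (hc k), congrArg W (hc k)⟩⟩

end Adversary

lemma FirstOrderMethod.commRounds_succ_of_isComm (M : FirstOrderMethod) {n : ℕ}
    {f : Fin n → Ell2 → ℝ} {N : Network n} {t : ℕ} (h : M.isComm f N t) :
    M.commRounds f N (t + 1) = M.commRounds f N t + 1 := by
  rw [commRounds, commRounds, Nat.count_succ, if_pos h]

lemma FirstOrderMethod.commRounds_succ_of_not_isComm (M : FirstOrderMethod) {n : ℕ}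
    {f : Fin n → Ell2 → ℝ} {N : Network n} {t : ℕ} (h : ¬ M.isComm f N t) :
    M.commRounds f N (t + 1) = M.commRounds f N t := by
  rw [commRounds, commRounds, Nat.count_succ, if_neg h, add_zero]

/-- On the chain functions and the moving double star, the memories stay in the level spaces. -/
lemma FirstOrderMethod.memory_subset_levelSpace (M : FirstOrderMethod) {n k : ℕ}
    (e : Fin n ≃ Fin 3 × Fin (k + 3)) {U : Ell2 ≃ₗᵢ[ℝ] Ell2} (hU : M.start ∈ levelSpace U 0)
    (μ κ q : ℝ) {f : Fin n → Ell2 → ℝ} (hf : ∀ i, f i = chainFunction U M.start μ κ q (e i).1)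
    {N : Network n}
    (hN : ∀ t, N.graph t = (starGraph (linkNode k (M.commRounds f N t))).comap e)
    (t : ℕ) (i : Fin n) :
    M.memory f N t i ⊆ levelSpace U (nodeLevel (M.commRounds f N t) (e i)) := by
  induction t generalizing i with
  | zero =>
    rw [M.memory_zero, Set.singleton_subset_iff]
    exact levelSpace_mono U (Nat.zero_le _) hU
  | succ t ih =>
    by_cases h : M.isComm f N t
    · refine (M.memory_comm f N t h i).trans (Submodule.span_le.2 ?_)
      rintro z ⟨j, hj, hz⟩
      rw [M.commRounds_succ_of_isComm h]
      refine levelSpace_mono U (nodeLevel_le_succ _ ?_) (ih j hz)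
      rcases hj with rfl | hj
      · exact Or.inl rfl
      · rw [hN] at hj
        exact Or.inr hj
    · refine (M.memory_local f N t h i).trans (Submodule.span_le.2 ?_)
      rw [M.commRounds_succ_of_not_isComm h]
      have hc := isClosedLevel_nodeLevel (M.commRounds f N t) (e i)
      rintro z ⟨x, hx, rfl | rfl | rfl⟩
      · exact ih i hx
      · rw [hf]
        exact gradient_chainFunction_mem hc hU (ih i hx)
      · rw [hf]
        exact gradient_fenchelDual_chainFunction_mem hc hU (ih i hx)

/-! ### Numerical estimates and conclusion. -/

lemma sqrt_chain_parameter_le {L μ : ℝ} (hμ : 0 < μ) (hL : 16 * μ < L) :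
    Real.sqrt (6 * μ / (L - μ)) * Real.sqrt (L / μ) ≤ 3 := by
  rw [← Real.sqrt_mul (div_nonneg (by linarith) (by linarith))]
  refine Real.sqrt_le_iff.2 ⟨by norm_num, ?_⟩
  have h : 0 < L - μ := by linarith
  rw [show 6 * μ / (L - μ) * (L / μ) = 6 * L / (L - μ) by field_simp, div_le_iff₀ h]
  linarith

lemma log_one_div_le_of_pow_le {q ε : ℝ} {m : ℕ} (hq : 0 < q) (h : (q ^ m) ^ 2 ≤ ε) :
    Real.log (1 / ε) ≤ 2 * m * Real.log (1 / q) := by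
  have h1 := Real.log_le_log (by positivity) h
  rw [Real.log_pow, Real.log_pow] at h1
  rw [one_div, one_div, Real.log_inv, Real.log_inv]
  push_cast at h1
  linarith

/-- The count of the rounds that are needed to reach level `m`, in terms of the accuracy. -/
lemma rounds_lower_bound {χ s l b : ℝ} {k r m : ℕ} (hs : 4 ≤ s) (hl : 6 ≤ l)
    (hbs : b * s ≤ 3) (hlm : l ≤ 2 * m * (2 * b)) (hm : m ≤ r / (k + 3) + 1)
    (hk : χ < 16 * (k + 1) + 56) : 1 / 768 * χ * s * l ≤ r := by
  have h1 : s * l ≤ 12 * m := by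
    have := mul_le_mul_of_nonneg_left hlm (show 0 ≤ s by linarith)
    have h2 : (4 * m) * (b * s) ≤ (4 * m) * (3 : ℝ) := mul_le_mul_of_nonneg_left hbs (by positivity)
    linarith
  -- Since `s * l / 12 ≥ 2`, passing from `m` to `m - 1` costs at most a factor 2.
  have h2 : (24 : ℝ) ≤ s * l := by nlinarith
  have h3 : ((k : ℝ) + 3) * (m - 1) ≤ r := by
    have h4 : (k + 3) * (r / (k + 3)) ≤ r := Nat.mul_div_le _ _
    have h5 : ((k : ℝ) + 3) * ((r / (k + 3) : ℕ) : ℝ) ≤ r := by exact_mod_cast h4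
    have h6 : (m : ℝ) ≤ ((r / (k + 3) : ℕ) : ℝ) + 1 := by exact_mod_cast hm
    refine le_trans (mul_le_mul_of_nonneg_left ?_ (by positivity)) h5
    linarith
  have h4 : s * l / 24 ≤ m - 1 := by linarith
  have h5 : χ / 32 ≤ (k : ℝ) + 3 := by linarith
  have h6 := mul_le_mul h5 h4 (by positivity) (by positivity)
  linarith

end Decentralized

theorem mainTheorem5 :
    ∃ c : ℝ, 0 < c ∧ ∃ ε₀ : ℝ, 0 < ε₀ ∧ ε₀ < 1 ∧
      ∀ χ L μ : ℝ, 56 ≤ χ → 0 < μ → 16 * μ < L →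
        ∀ M : Decentralized.FirstOrderMethod,
          ∃ (n : ℕ) (f : Fin n → Decentralized.Ell2 → ℝ) (N : Decentralized.Network n)
            (xstar : Decentralized.Ell2),
            (∀ i, Decentralized.IsSmooth L (f i) ∧ Decentralized.IsStronglyConvex μ (f i)) ∧
            (∀ k, Decentralized.IsGossipMatrix (N.graph k) (N.gossip k) ∧
              (N.gossip k).PosSemidef ∧
              Decentralized.conditionNumber (N.gossip k) = χ) ∧
            (∀ k, (symmDiff (N.graph k).edgeSet (N.graph (k + 1)).edgeSet).ncard ≤ 2) ∧
            (∀ y, Decentralized.globalFunction f xstar ≤ Decentralized.globalFunction f y) ∧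
            ∀ ε : ℝ, 0 < ε → ε ≤ ε₀ →
              ∀ (k : ℕ) (i : Fin n), ∀ x ∈ M.memory f N k i,
                ‖x - xstar‖ ^ 2 ≤ ε * ‖M.start - xstar‖ ^ 2 →
                  c * χ * Real.sqrt (L / μ) * Real.log (1 / ε) ≤ (M.commRounds f N k : ℝ) := by
  open Decentralized in
  -- Here `768 = 32 * 24`, from `χ / 32 ≤ k + 3` and `s * l / 24 ≤ m - 1`. The choice `ε₀ = exp
  -- (-6)` gives `log (1 / ε) ≥ 6`, and `L > 16 * μ` gives `√(L / μ) ≥ 4`.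
  refine ⟨1 / 768, by norm_num, Real.exp (-6), Real.exp_pos _, Real.exp_lt_one_iff.2 (by norm_num), ?_⟩
  intro χ L μ hχ hμ hL M
  have hLμ : 0 < L - μ := by linarith
  -- The largest `k` with `8 * (k + 3) + 4 ≤ χ / 2`; the case `k = 0` requires `χ ≥ 56`.
  obtain ⟨k, hk1, hk2⟩ : ∃ k : ℕ, 16 * (k : ℝ) + 56 ≤ χ ∧ χ < 16 * ((k : ℝ) + 1) + 56 := by
    refine ⟨⌊(χ - 56) / 16⌋₊, ?_, ?_⟩
    · have := Nat.floor_le (show 0 ≤ (χ - 56) / 16 by linarith)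
      linarith
    · have := Nat.lt_floor_add_one ((χ - 56) / 16)
      linarith
  obtain ⟨U, hU⟩ := exists_isometry_mem_levelSpace_zero M.start
  obtain ⟨q, hq0, hq1, hq, hlogq⟩ := exists_chain_ratio (show 0 < 6 * μ / (L - μ) by positivity)
  set κ := (L - μ) / 4 with hκ
  have hκ0 : 0 ≤ κ := by positivity
  have hstat : 3 * μ * q = 2 * κ * (1 - q) ^ 2 := by
    rw [← hq, hκ]
    field_simp
    ring
  let e : Fin (3 * (k + 3)) ≃ Fin 3 × Fin (k + 3) := finProdFinEquiv.symm
  let f : Fin (3 * (k + 3)) → Ell2 → ℝ := fun i => chainFunction U M.start μ κ q (e i).1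
  have hconv : ∀ i, IsStronglyConvex μ (f i) := fun i =>
    isStronglyConvex_quadratic _ hκ0 (signedInvolution_involutive U _ _)
  obtain ⟨N, hN⟩ := M.exists_network f (fun r => (starGraph (linkNode k r)).comap e)
    (fun r => (starMatrix (χ / 2) (linkNode k r)).submatrix e e)
  have hframe := fun p : Fin (k + 3) =>
    starMatrix_spectralFrame (β := χ / 2) p (by linarith)
  refine ⟨3 * (k + 3), f, N, M.start + U.symm (geometricVector q hq0.le hq1), fun i => ⟨?_, hconv i⟩,
    fun t => ?_, fun t => ?_, ?_, ?_⟩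
  · have := isSmooth_quadratic (chainShift U M.start μ κ q (e i).1) hμ.le hκ0
      (signedInvolution_involutive U (chainPerm_involutive (e i).1) (chainSign_chainPerm (e i).1))
    rwa [show μ + 4 * κ = L by rw [hκ]; ring] at this
  · rw [(hN t).1, (hN t).2]
    refine ⟨(hframe _).isGossipMatrix_submatrix e fun i j => starMatrix_apply_eq_zero _ _,
      (hframe _).posSemidef.submatrix e, ?_⟩
    rw [(hframe _).conditionNumber_submatrix e]
    ring
  · rw [(hN t).1, (hN (t + 1)).1]
    by_cases h : M.isComm f N t
    · rw [M.commRounds_succ_of_isComm h]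
      exact ncard_symmDiff_comap_edgeSet_le e (linkNode_succ k _).1 (linkNode_succ k _).2
    · rw [M.commRounds_succ_of_not_isComm h]
      simp
  · refine globalFunction_le_of_sum_gradient_eq_zero hμ.le hconv ?_
    -- Each kind occurs at `k + 3` nodes, so the sum splits into copies of the sum over the three
    -- kinds.
    rw [← e.symm.sum_comp, Fintype.sum_prod_type, Finset.sum_comm]
    refine Finset.sum_eq_zero fun j _ => ?_
    simp only [f, Equiv.apply_symm_apply]
    exact sum_gradient_chainFunction hU hstat
  · intro ε hε hε0 t i x hx hxε
    have hmem := M.memory_subset_levelSpace e hU μ κ q (fun _ => rfl) (fun t => (hN t).1) t i hx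
    have hD : 0 < ‖M.start - (M.start + U.symm (geometricVector q hq0.le hq1))‖ ^ 2 := by
      rw [sub_add_cancel_left, norm_neg, U.symm.norm_map]
      have := norm_pos_iff.2 (geometricVector_ne_zero (h0 := hq0.le) (h1 := hq1) hq0)
      positivity
    have hpow := le_of_mul_le_mul_right ((pow_mul_norm_le_norm_sub hU hmem).trans hxε) hD
    have hlog := log_one_div_le_of_pow_le hq0 hpow
    refine rounds_lower_bound (b := Real.sqrt (6 * μ / (L - μ))) (Real.le_sqrt_of_sq_le ?_) ?_
      (sqrt_chain_parameter_le hμ hL) (hlog.trans ?_) (nodeLevel_le _ (e i)) hk2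
    · rw [le_div_iff₀ hμ]
      linarith
    · rw [one_div, Real.log_inv]
      have := Real.log_le_log hε hε0
      rw [Real.log_exp] at this
      linarith
    · exact mul_le_mul_of_nonneg_left hlogq (by positivity)
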